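/- Let $\mathbb{D}=\{z\in\mathbb{C}:|z|<1\}$ and $d\in[1,+\infty]$. Consider the following conditions on a family $(\varphi_{s,t})_{0\le s\le t<+\infty}$ of holomorphic self-maps of $\mathbb{D}$: - REF1: $\varphi_{s,s}=\mathrm{id}_{\mathbb{D}}$ for all $s\ge 0$; - REF2: $\varphi_{s,t}=\varphi_{s,u}\circ\varphi_{u,t}$ whenever $0\le s\le u\le t<+\infty$; - REF3: for any $z\in\mathbb{D}$ and any $T>0$ there exists a non-negative function $k_{z,T}\in L^d([0,T],\mathbb{R})$ such that $|\varphi_{s,u}(z)-\varphi_{s,t}(z)|\le\int_u^t k_{z,T}(\xi)\,d\xi$ whenever $0\le s\le u\le t\le T$. The family is a *reverse evolution family of order $d$* if REF1, REF2 and REF3 hold, and an *evolution family of order $d$* if REF1 and REF3 hold together with $\varphi_{s,t}=\varphi_{u,t}\circ\varphi_{s,u}$ whenever $0\le s\le u\le t<+\infty$. **Proposition.** Let $d\in[1,+\infty]$ and suppose that a family $(\varphi_{s,t})_{0\le s\le t<+\infty}$ of holomorphic self-maps of $\mathbb{D}$ satisfies REF1 and REF2. Then the following conditions are equivalent: (i)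 for each $T>0$ there exist two distinct points $\zeta_1,\zeta_2\in\mathbb{D}$ and a non-negative function $k_T\in L^d([0,T],\mathbb{R})$ such that, for $j=1,2$, $$|\varphi_{s,t}(\zeta_j)-\varphi_{s,u}(\zeta_j)|\le\int_u^t k_T(\xi)\,d\xi\quad\text{whenever }0\le s\le u\le t\le T;$$ (ii) $(\varphi_{s,t})$ satisfies REF3, i.e. $(\varphi_{s,t})$ is a reverse evolution family of order $d$; (iii) for any $T>0$ and any compact set $K\subset\mathbb{D}$ there exists a non-negative function $k_{K,T}\in L^d([0,T],\mathbb{R})$ such that, for all $z\in K$, $$|\varphi_{s,t}(z)-\varphi_{s,u}(z)|\le\int_u^t k_{K,T}(\xi)\,d\xi\quad\text{whenever }0\le s\le u\le t\le T;$$ (iv) for any $T>0$ there exists an evolution family $(\varphi^T_{s,t})_{0\le s\le t<+\infty}$ of order $d$ such that $\varphi_{s,t}=\varphi^T_{T-t,T-s}$ whenever $0\le s\le t\le T$; (v) for any $T>0$ and any compact set $K\subset\mathbb{D}$ there exists a non-negative function $k_{K,T}\in L^d([0,T],\mathbb{R})$ such that, for all $z\in K$, $$|\varphi_{s,t}(z)-\varphi_{u,t}(z)|\le\int_s^u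 k_{K,T}(\xi)\,d\xi\quad\text{whenever }0\le s\le u\le t\le T.$$ In particular, every element $\varphi_{s,t}$ $(0\le s\le t<+\infty)$ of any reverse evolution family of order $d$ is a univalent (that is, holomorphic and injective) function in $\mathbb{D}$. -/

import Mathlib

open MeasureTheory Set
open scoped ENNReal

namespace Loewner

/-- The open unit disc in the complex plane. -/
abbrev disc : Set ℂ := Metric.ball (0 : ℂ) 1

/-- `φ s t`, for `0 ≤ s ≤ t`, is a family of holomorphic self-maps of the unit disc. A family is
encoded as a total function; only the values `φ s t z` with `0 ≤ s ≤ t` and `|z| < 1` matter. -/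
def IsSelfMapFamily (φ : ℝ → ℝ → ℂ → ℂ) : Prop :=
  ∀ s t : ℝ, 0 ≤ s → s ≤ t → DifferentiableOn ℂ (φ s t) disc ∧ MapsTo (φ s t) disc disc

/-- Univalent in the unit disc: holomorphic and injective. -/
def IsUnivalent (f : ℂ → ℂ) : Prop :=
  DifferentiableOn ℂ f disc ∧ InjOn f disc

/-- `k` is a non-negative function in `L^d([0,T], ℝ)`. -/
def IsNonnegLp (d : ℝ≥0∞) (T : ℝ) (k : ℝ → ℝ) : Prop :=
  (∀ ξ ∈ Icc 0 T, 0 ≤ k ξ) ∧ MemLp k d (volume.restrict (Icc 0 T))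

/-- The diagonal condition `φ_{s,s} = id`, common to evolution families and reverse ones. -/
def DiagId (φ : ℝ → ℝ → ℂ → ℂ) : Prop :=
  ∀ s : ℝ, 0 ≤ s → ∀ z ∈ disc, φ s s z = z

/-- The composition rule `φ_{s,t} = φ_{u,t} ∘ φ_{s,u}` of evolution families. -/
def ForwardComp (φ : ℝ → ℝ → ℂ → ℂ) : Prop :=
  ∀ s u t : ℝ, 0 ≤ s → s ≤ u → u ≤ t → ∀ z ∈ disc, φ s t z = φ u t (φ s u z)

/-- The composition rule `φ_{s,t} = φ_{s,u} ∘ φ_{u,t}` of reverse evolution families. -/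
def ReverseComp (φ : ℝ → ℝ → ℂ → ℂ) : Prop :=
  ∀ s u t : ℝ, 0 ≤ s → s ≤ u → u ≤ t → ∀ z ∈ disc, φ s t z = φ s u (φ u t z)

/-- Pointwise `L^d` absolute continuity in the second parameter. -/
def PointwiseACd (d : ℝ≥0∞) (φ : ℝ → ℝ → ℂ → ℂ) : Prop :=
  ∀ z ∈ disc, ∀ T : ℝ, 0 < T → ∃ k : ℝ → ℝ, IsNonnegLp d T k ∧
    ∀ s u t : ℝ, 0 ≤ s → s ≤ u → u ≤ t → t ≤ T →
      ‖φ s u z - φ s t z‖ ≤ ∫ ξ in u..t, k ξ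

/-- Evolution family of order `d` in the unit disc. -/
structure IsEvolutionFamily (d : ℝ≥0∞) (φ : ℝ → ℝ → ℂ → ℂ) : Prop where
  selfMap : IsSelfMapFamily φ
  diag : DiagId φ
  comp : ForwardComp φ
  ac : PointwiseACd d φ

/-- Reverse evolution family of order `d` in the unit disc. -/
structure IsReverseEvolutionFamily (d : ℝ≥0∞) (φ : ℝ → ℝ → ℂ → ℂ) : Prop where
  selfMap : IsSelfMapFamily φ
  diag : DiagId φ
  comp : ReverseComp φ
  ac : PointwiseACd d φ

/-- The `L^d` bound in the second parameter at two distinct points, which may depend on `T`. -/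
def TwoPointACd (d : ℝ≥0∞) (φ : ℝ → ℝ → ℂ → ℂ) : Prop :=
  ∀ T : ℝ, 0 < T → ∃ ζ₁ ∈ disc, ∃ ζ₂ ∈ disc, ζ₁ ≠ ζ₂ ∧ ∃ k : ℝ → ℝ, IsNonnegLp d T k ∧
    ∀ s u t : ℝ, 0 ≤ s → s ≤ u → u ≤ t → t ≤ T →
      ‖φ s t ζ₁ - φ s u ζ₁‖ ≤ ∫ ξ in u..t, k ξ ∧
      ‖φ s t ζ₂ - φ s u ζ₂‖ ≤ ∫ ξ in u..t, k ξ

/-- The `L^d` bound in the second parameter, uniform on compact subsets of the disc. -/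
def LocUnifACdSnd (d : ℝ≥0∞) (φ : ℝ → ℝ → ℂ → ℂ) : Prop :=
  ∀ T : ℝ, 0 < T → ∀ K : Set ℂ, IsCompact K → K ⊆ disc → ∃ k : ℝ → ℝ, IsNonnegLp d T k ∧
    ∀ z ∈ K, ∀ s u t : ℝ, 0 ≤ s → s ≤ u → u ≤ t → t ≤ T →
      ‖φ s t z - φ s u z‖ ≤ ∫ ξ in u..t, k ξ

/-- On every `[0,T]`, time reversal turns `φ` into (part of) an evolution family of order `d`. -/
def TimeReversalIsEvolution (d : ℝ≥0∞) (φ : ℝ → ℝ → ℂ → ℂ) : Prop :=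
  ∀ T : ℝ, 0 < T → ∃ ψ : ℝ → ℝ → ℂ → ℂ, IsEvolutionFamily d ψ ∧
    ∀ s t : ℝ, 0 ≤ s → s ≤ t → t ≤ T → ∀ z ∈ disc, φ s t z = ψ (T - t) (T - s) z

/-- The `L^d` bound in the first parameter, uniform on compact subsets of the disc. -/
def LocUnifACdFst (d : ℝ≥0∞) (φ : ℝ → ℝ → ℂ → ℂ) : Prop :=
  ∀ T : ℝ, 0 < T → ∀ K : Set ℂ, IsCompact K → K ⊆ disc → ∃ k : ℝ → ℝ, IsNonnegLp d T k ∧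
    ∀ z ∈ K, ∀ s u t : ℝ, 0 ≤ s → s ≤ u → u ≤ t → t ≤ T →
      ‖φ s t z - φ u t z‖ ≤ ∫ ξ in s..u, k ξ

end Loewner

/-!
All the conditions on `φ` are compared with one more, `LocUnifDisplacement`: the displacement
`‖φ s t z - z‖` is at most the integral over `[s, t]` of an `L^d` function that serves all points of a
given smaller disc.

The heart of the matter is a two-point estimate (`exists_norm_map_sub_self_le`): for a holomorphic
self-map `f` of the disc, `‖f z - z‖` is bounded, uniformly in `f` and locally uniformly in `z`, by a
constant times `‖f ζ₁ - ζ₁‖ + ‖f ζ₂ - ζ₂‖`. After a conjugation, `ζ₁ = 0`, and after a composition with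
a disc automorphism, `f 0 = 0`; then `f z = z * g z` with `g` a map into the closed disc, and the
Schwarz–Pick lemma for `g` compares `1 - g z` with `1 - g ζ`. Thus a bound on displacements at two
points gives `LocUnifDisplacement`.

The other implications use the composition rule. Increments in the second parameter are
`φ s u (φ u t z) - φ s u z`, to which the Schwarz–Pick Lipschitz bound for `φ s u` applies. Increments
in the first parameter are `φ s u w - w` with `w = φ u t z`, and `w` stays in a common smaller disc
because `[0, T]` is a finite union of intervals on which the maps move `0` by at most `1 / 2`
(`LocUnifDisplacement.exists_norm_le`). Reversing time exchanges the two kinds of increments.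

For univalence, the set of `u` such that `φ u t` identifies two given distinct points is closed, so it
would have a last element `u < t`; but for `v` just after `u` the map `φ u v` is close enough to the
identity to be injective on a compact set that contains the relevant values
(`LocUnifDisplacement.injOn`).
-/

namespace Loewner

open Filter Topology
open scoped ComplexConjugate

/-! ### Disc automorphisms and the Schwarz–Pick lemma -/

/-- The automorphism `w ↦ (w - a) / (1 - conj a * w)` of the unit disc, for `a` in the disc. It
sends `a` to `0`, and its inverse is `mob (-a)`. -/
noncomputable def mob (a w : ℂ) : ℂ := (w - a) / (1 - conj a * w)

lemma norm_lt_one {z : ℂ} (hz : z ∈ disc) : ‖z‖ < 1 := mem_ball_zero_iff.1 hz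

lemma neg_mem_disc {a : ℂ} (ha : a ∈ disc) : -a ∈ disc := by
  rw [mem_ball_zero_iff, norm_neg]; exact norm_lt_one ha

lemma norm_conj_mul_lt_one {a w : ℂ} (ha : a ∈ disc) (hw : ‖w‖ ≤ 1) : ‖conj a * w‖ < 1 := by
  rw [norm_mul, RCLike.norm_conj]
  have := norm_lt_one ha
  nlinarith [norm_nonneg a, norm_nonneg w]

lemma one_sub_conj_mul_ne_zero {a w : ℂ} (ha : a ∈ disc) (hw : ‖w‖ ≤ 1) :
    1 - conj a * w ≠ 0 := by
  intro h
  have := norm_conj_mul_lt_one ha hw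
  rw [← sub_eq_zero.1 h] at this
  simp at this

lemma norm_one_sub_conj_mul_le {a w : ℂ} (ha : ‖a‖ ≤ 1) (hw : ‖w‖ ≤ 1) :
    ‖1 - conj a * w‖ ≤ 2 := by
  have h : ‖1 - conj a * w‖ ≤ 1 + ‖a‖ * ‖w‖ := by
    simpa using norm_sub_le (1 : ℂ) (conj a * w)
  nlinarith [norm_nonneg a, norm_nonneg w]

lemma one_sub_norm_le {a w : ℂ} (hw : ‖w‖ ≤ 1) : 1 - ‖a‖ ≤ ‖1 - conj a * w‖ := by
  have h : 1 - ‖a‖ * ‖w‖ ≤ ‖1 - conj a * w‖ := by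
    simpa using norm_sub_norm_le (1 : ℂ) (conj a * w)
  nlinarith [norm_nonneg a, norm_nonneg w]

lemma sq_norm_one_sub_conj_mul_sub (a w : ℂ) :
    ‖1 - conj a * w‖ ^ 2 - ‖w - a‖ ^ 2 = (1 - ‖a‖ ^ 2) * (1 - ‖w‖ ^ 2) := by
  simp only [Complex.sq_norm, Complex.normSq_apply, Complex.sub_re, Complex.sub_im,
    Complex.mul_re, Complex.mul_im, Complex.conj_re, Complex.conj_im, Complex.one_re,
    Complex.one_im]
  ring

/-- The pseudo-hyperbolic distance `‖mob a w‖` stays away from `1`, quantitatively. -/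
lemma norm_mob_le {a w : ℂ} (ha : a ∈ disc) (hw : w ∈ disc) :
    ‖mob a w‖ ≤ 1 - (1 - ‖a‖) * (1 - ‖w‖) / 8 := by
  have ha' := norm_lt_one ha
  have hw' := norm_lt_one hw
  have hY := norm_pos_iff.2 (one_sub_conj_mul_ne_zero ha hw'.le)
  have hY2 := norm_one_sub_conj_mul_le ha'.le hw'.le
  have hid := sq_norm_one_sub_conj_mul_sub a w
  have hX0 := norm_nonneg (w - a)
  have ha0 := norm_nonneg a
  have hw0 := norm_nonneg w
  rw [mob, norm_div, div_le_iff₀ hY]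
  generalize ‖1 - conj a * w‖ = Y at *
  generalize ‖w - a‖ = X at *
  generalize ‖a‖ = x at *
  generalize ‖w‖ = y at *
  have hc : 0 < (1 - x) * (1 - y) := mul_pos (by linarith) (by linarith)
  have hge : (1 - x) * (1 - y) ≤ Y ^ 2 - X ^ 2 := by
    rw [hid]
    exact mul_le_mul (by nlinarith) (by nlinarith) (by linarith) (by nlinarith)
  have hXY : X ≤ Y := by nlinarith
  have h4 : (1 - x) * (1 - y) ≤ 4 * (Y - X) := by nlinarith
  nlinarith

lemma mob_mem_disc {a w : ℂ} (ha : a ∈ disc) (hw : w ∈ disc) : mob a w ∈ disc := by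
  rw [mem_ball_zero_iff]
  have := norm_mob_le ha hw
  have := mul_pos (sub_pos.2 (norm_lt_one ha)) (sub_pos.2 (norm_lt_one hw))
  linarith

lemma mapsTo_mob {a : ℂ} (ha : a ∈ disc) : MapsTo (mob a) disc disc :=
  fun _ hw => mob_mem_disc ha hw

lemma differentiableOn_mob {a : ℂ} (ha : a ∈ disc) : DifferentiableOn ℂ (mob a) disc := by
  intro w hw
  have := one_sub_conj_mul_ne_zero ha (norm_lt_one hw).le
  unfold mob
  fun_prop (disch := assumption)

@[simp] lemma mob_self (a : ℂ) : mob a a = 0 := by simp [mob]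

lemma mob_neg_mob {a w : ℂ} (ha : a ∈ disc) (hw : w ∈ disc) : mob (-a) (mob a w) = w := by
  have h1 := one_sub_conj_mul_ne_zero ha (norm_lt_one hw).le
  have h2 := one_sub_conj_mul_ne_zero ha (norm_lt_one ha).le
  have h3 : 1 - conj (-a) * mob a w = (1 - conj a * a) / (1 - conj a * w) := by
    rw [mob, map_neg]; field_simp; ring
  rw [mob, h3, mob, div_eq_iff (div_ne_zero h2 h1), mul_div_assoc', eq_div_iff h1, sub_mul,
    div_mul_cancel₀ _ h1]
  ring

/-- The **Schwarz–Pick lemma**: holomorphic self-maps of the disc contract the pseudo-hyperbolic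
distance. -/
lemma norm_mob_map_le {f : ℂ → ℂ} (hf : DifferentiableOn ℂ f disc) (hm : MapsTo f disc disc)
    {a w : ℂ} (ha : a ∈ disc) (hw : w ∈ disc) : ‖mob (f a) (f w)‖ ≤ ‖mob a w‖ := by
  have hna := neg_mem_disc ha
  have hd : DifferentiableOn ℂ (fun z => mob (f a) (f (mob (-a) z))) disc :=
    (differentiableOn_mob (hm ha)).comp (hf.comp (differentiableOn_mob hna) (mapsTo_mob hna))
      (hm.comp (mapsTo_mob hna))
  have hmaps : MapsTo (fun z => mob (f a) (f (mob (-a) z))) disc (Metric.closedBall 0 1) :=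
    fun z hz => Metric.ball_subset_closedBall (mob_mem_disc (hm ha) (hm (mob_mem_disc hna hz)))
  have h := Complex.norm_le_norm_of_mapsTo_ball hd hmaps (by simp [mob])
    (norm_lt_one (mob_mem_disc ha hw))
  simpa only [mob_neg_mob ha hw] using h

lemma norm_map_sub_le_mob {f : ℂ → ℂ} (hf : DifferentiableOn ℂ f disc) (hm : MapsTo f disc disc)
    {a w : ℂ} (ha : a ∈ disc) (hw : w ∈ disc) :
    ‖f w - f a‖ ≤ ‖mob a w‖ * ‖1 - conj (f a) * f w‖ := by
  have h := norm_mob_map_le hf hm ha hw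
  have h1 := one_sub_conj_mul_ne_zero (hm ha) (norm_lt_one (hm hw)).le
  rwa [mob, norm_div, div_le_iff₀ (norm_pos_iff.2 h1)] at h

/-- The Schwarz–Pick lemma for maps into the closed disc, where the maximum modulus principle is
avoided by scaling the map by `t < 1` and letting `t → 1`. -/
lemma norm_map_sub_le_mob_of_closedBall {f : ℂ → ℂ} (hf : DifferentiableOn ℂ f disc)
    (hm : MapsTo f disc (Metric.closedBall 0 1)) {a w : ℂ} (ha : a ∈ disc) (hw : w ∈ disc) :
    ‖f w - f a‖ ≤ ‖mob a w‖ * ‖1 - conj (f a) * f w‖ := by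
  have key : ∀ t ∈ Ioo (0 : ℝ) 1, ‖(t : ℂ) * f w - t * f a‖ ≤
      ‖mob a w‖ * ‖1 - conj (t * f a) * (t * f w)‖ := by
    intro t ht
    refine norm_map_sub_le_mob (f := fun z => (t : ℂ) * f z) (hf.const_mul _) ?_ ha hw
    intro z hz
    have := mem_closedBall_zero_iff.1 (hm hz)
    rw [mem_ball_zero_iff, norm_mul, Complex.norm_real, Real.norm_of_nonneg ht.1.le]
    nlinarith [ht.1, ht.2, norm_nonneg (f z)]
  have hev : ∀ᶠ t : ℝ in 𝓝[<] 1, t ∈ Ioo (0 : ℝ) 1 := Ioo_mem_nhdsLT one_pos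
  have hl : Tendsto (fun t : ℝ => ‖(t : ℂ) * f w - t * f a‖) (𝓝[<] 1) (𝓝 ‖f w - f a‖) := by
    have : Continuous (fun t : ℝ => ‖(t : ℂ) * f w - t * f a‖) := by fun_prop
    simpa using (this.tendsto 1).mono_left nhdsWithin_le_nhds
  have hr : Tendsto (fun t : ℝ => ‖mob a w‖ * ‖1 - conj (t * f a) * (t * f w)‖) (𝓝[<] 1)
      (𝓝 (‖mob a w‖ * ‖1 - conj (f a) * f w‖)) := by
    have : Continuous (fun t : ℝ => ‖mob a w‖ * ‖1 - conj (t * f a) * (t * f w)‖) := by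
      simp only [map_mul, Complex.conj_ofReal]; fun_prop
    simpa using (this.tendsto 1).mono_left nhdsWithin_le_nhds
  exact le_of_tendsto_of_tendsto hl hr (hev.mono key)

/-- The Euclidean Lipschitz bound contained in the Schwarz–Pick lemma: the constant depends on one
of the two points only. -/
lemma norm_map_sub_le {f : ℂ → ℂ} (hf : DifferentiableOn ℂ f disc) (hm : MapsTo f disc disc)
    {a w : ℂ} (ha : a ∈ disc) (hw : w ∈ disc) :
    ‖f w - f a‖ ≤ 2 / (1 - ‖a‖) * ‖w - a‖ := by
  have h1 : 0 < 1 - ‖a‖ := sub_pos.2 (norm_lt_one ha)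
  have h2 := norm_one_sub_conj_mul_le (norm_lt_one (hm ha)).le (norm_lt_one (hm hw)).le
  have h3 : ‖mob a w‖ ≤ ‖w - a‖ / (1 - ‖a‖) := by
    rw [mob, norm_div]
    exact div_le_div_of_nonneg_left (norm_nonneg _) h1 (one_sub_norm_le (norm_lt_one hw).le)
  calc ‖f w - f a‖ ≤ ‖mob a w‖ * ‖1 - conj (f a) * f w‖ := norm_map_sub_le_mob hf hm ha hw
    _ ≤ ‖w - a‖ / (1 - ‖a‖) * 2 := by gcongr
    _ = _ := by ring

/-- A self-map of the disc that does not move `0` too far cannot send a point too close to the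
unit circle. -/
lemma one_sub_norm_map_ge {f : ℂ → ℂ} (hf : DifferentiableOn ℂ f disc) (hm : MapsTo f disc disc)
    {z : ℂ} (hz : z ∈ disc) : (1 - ‖f 0‖) * (1 - ‖z‖) / 8 ≤ 1 - ‖f z‖ := by
  have h0 : (0 : ℂ) ∈ disc := by simp
  have h1 : ‖mob (f 0) (f z)‖ ≤ ‖z‖ := by
    simpa [mob] using norm_mob_map_le hf hm h0 hz
  have h2 := norm_mob_le (neg_mem_disc (hm h0)) (mob_mem_disc (hm h0) (hm hz))
  rw [mob_neg_mob (hm h0) (hm hz), norm_neg] at h2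
  have := norm_lt_one (hm h0)
  nlinarith

/-! ### Two points control the distance to the identity -/

/-- With `f z = z * g z`, the Schwarz–Pick lemma for `g` compares `1 - g z` with `1 - g ζ`. -/
lemma norm_map_sub_self_le_of_map_zero {f : ℂ → ℂ} (hf : DifferentiableOn ℂ f disc)
    (hm : MapsTo f disc disc) (h0 : f 0 = 0) {ζ z : ℂ} (hζ : ζ ∈ disc) (hζ0 : ζ ≠ 0)
    (hz : z ∈ disc) :
    ‖f z - z‖ ≤ 16 / ((1 - ‖ζ‖) * (1 - ‖z‖)) / ‖ζ‖ * ‖f ζ - ζ‖ := by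
  have hm' : MapsTo f (Metric.ball 0 1) (Metric.closedBall (f 0) 1) := by
    rw [h0]; exact fun w hw => Metric.ball_subset_closedBall (hm hw)
  set g := dslope f 0 with hg
  have hfg : ∀ w, f w = w * g w := fun w => by
    simpa [h0] using (sub_smul_dslope f 0 w).symm
  have hgd : DifferentiableOn ℂ g disc :=
    (Complex.differentiableOn_dslope (Metric.ball_mem_nhds 0 one_pos)).2 hf
  have hgm : MapsTo g disc (Metric.closedBall 0 1) := fun w hw => by
    simpa using Complex.norm_dslope_le_div_of_mapsTo_ball hf hm' hw
  have hsp := norm_map_sub_le_mob_of_closedBall hgd hgm hζ hz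
  have hq := norm_mob_le hζ hz
  have hq0 := norm_nonneg (mob ζ z)
  have hz1 : ‖g z‖ ≤ 1 := mem_closedBall_zero_iff.1 (hgm hz)
  have h1 : ‖1 - conj (g ζ) * g z‖ ≤ ‖1 - g z‖ + ‖1 - g ζ‖ := by
    have e : 1 - conj (g ζ) * g z = (1 - g z) + g z * conj (1 - g ζ) := by
      rw [map_sub, map_one]; ring
    rw [e]
    refine (norm_add_le _ _).trans ?_
    rw [norm_mul, RCLike.norm_conj]
    nlinarith [norm_nonneg (1 - g ζ)]
  have h2 : ‖1 - g z‖ ≤ ‖g z - g ζ‖ + ‖1 - g ζ‖ := by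
    have e : 1 - g z = (1 - g ζ) - (g z - g ζ) := by ring
    rw [e]
    exact (norm_sub_le _ _).trans_eq (add_comm _ _)
  have hc : 0 < (1 - ‖ζ‖) * (1 - ‖z‖) :=
    mul_pos (sub_pos.2 (norm_lt_one hζ)) (sub_pos.2 (norm_lt_one hz))
  have hA := norm_nonneg (1 - g z)
  have hB := norm_nonneg (1 - g ζ)
  have h3 : ‖1 - g z‖ ≤ 16 / ((1 - ‖ζ‖) * (1 - ‖z‖)) * ‖1 - g ζ‖ := by
    rw [div_mul_eq_mul_div, le_div_iff₀ hc]
    have h4 : ‖g z - g ζ‖ ≤ ‖mob ζ z‖ * (‖1 - g z‖ + ‖1 - g ζ‖) :=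
      hsp.trans (mul_le_mul_of_nonneg_left h1 hq0)
    nlinarith
  have h5 : ‖f z - z‖ ≤ ‖1 - g z‖ := by
    have e : f z - z = -(z * (1 - g z)) := by rw [hfg]; ring
    rw [e, norm_neg, norm_mul]
    nlinarith [norm_lt_one hz]
  have h6 : ‖1 - g ζ‖ = ‖f ζ - ζ‖ / ‖ζ‖ := by
    have e : f ζ - ζ = -(ζ * (1 - g ζ)) := by rw [hfg]; ring
    rw [e, norm_neg, norm_mul]
    field_simp [norm_ne_zero_iff.2 hζ0]
  calc ‖f z - z‖ ≤ _ := h5.trans h3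
    _ = _ := by rw [h6]; ring

/-- The automorphism `mob a` is `O(a)`-close to the identity. -/
lemma norm_mob_sub_self_le {a w : ℂ} (ha : ‖a‖ ≤ 1 / 2) (hw : w ∈ disc) :
    ‖mob a w - w‖ ≤ 4 * ‖a‖ := by
  have hw' := norm_lt_one hw
  have ha' : a ∈ disc := by rw [mem_ball_zero_iff]; linarith
  have h1 := one_sub_conj_mul_ne_zero ha' hw'.le
  have h2 := one_sub_norm_le (a := a) hw'.le
  have e : mob a w - w = (conj a * w ^ 2 - a) / (1 - conj a * w) := by
    rw [mob, eq_div_iff h1, sub_mul, div_mul_cancel₀ _ h1]; ring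
  have h3 : ‖conj a * w ^ 2 - a‖ ≤ ‖a‖ * ‖w‖ ^ 2 + ‖a‖ := by
    have e : ‖a‖ * ‖w‖ ^ 2 = ‖conj a * w ^ 2‖ := by
      rw [norm_mul, norm_pow, RCLike.norm_conj]
    rw [e]
    exact norm_sub_le _ _
  rw [e, norm_div, div_le_iff₀ (norm_pos_iff.2 h1)]
  have h4 : ‖w‖ ^ 2 ≤ 1 := pow_le_one₀ (norm_nonneg _) hw'.le
  nlinarith [norm_nonneg a]

/-- When `f 0` is not `0`, it is moved to `0` by `mob (f 0)`; if `f 0` is far from `0`, the bound is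
trivial. -/
lemma norm_map_sub_self_le_of_zero {f : ℂ → ℂ} (hf : DifferentiableOn ℂ f disc)
    (hm : MapsTo f disc disc) {ζ z : ℂ} (hζ : ζ ∈ disc) (hζ0 : ζ ≠ 0) (hz : z ∈ disc) :
    ‖f z - z‖ ≤ (16 / ((1 - ‖ζ‖) * (1 - ‖z‖)) / ‖ζ‖ + 1) * 4 * (‖f 0‖ + ‖f ζ - ζ‖) := by
  have hc : 0 < (1 - ‖ζ‖) * (1 - ‖z‖) :=
    mul_pos (sub_pos.2 (norm_lt_one hζ)) (sub_pos.2 (norm_lt_one hz))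
  set C := 16 / ((1 - ‖ζ‖) * (1 - ‖z‖)) / ‖ζ‖ with hC
  have hC0 : 0 ≤ C := by positivity
  have hn1 := norm_nonneg (f 0)
  have hn2 := norm_nonneg (f ζ - ζ)
  rcases le_or_gt ‖f 0‖ (1 / 2) with h | h
  · have ha : f 0 ∈ disc := hm (by simp)
    have h1 := norm_map_sub_self_le_of_map_zero (f := fun w => mob (f 0) (f w))
      ((differentiableOn_mob ha).comp hf hm) ((mapsTo_mob ha).comp hm) (mob_self _) hζ hζ0 hz
    rw [← hC] at h1
    have h2 : ‖mob (f 0) (f ζ) - ζ‖ ≤ 4 * ‖f 0‖ + ‖f ζ - ζ‖ :=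
      (norm_sub_le_norm_sub_add_norm_sub _ (f ζ) _).trans
        (add_le_add_left (norm_mob_sub_self_le h (hm hζ)) _)
    have h3 : ‖f z - z‖ ≤ 4 * ‖f 0‖ + ‖mob (f 0) (f z) - z‖ := by
      refine (norm_sub_le_norm_sub_add_norm_sub _ (mob (f 0) (f z)) _).trans
        (add_le_add_left ?_ _)
      rw [norm_sub_rev]
      exact norm_mob_sub_self_le h (hm hz)
    have h4 : C * ‖mob (f 0) (f ζ) - ζ‖ ≤ C * (4 * ‖f 0‖ + ‖f ζ - ζ‖) :=
      mul_le_mul_of_nonneg_left h2 hC0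
    nlinarith [mul_nonneg hC0 hn2]
  · have h1 : ‖f z - z‖ ≤ 2 := by
      have := norm_sub_le (f z) z
      linarith [norm_lt_one hz, norm_lt_one (hm hz)]
    nlinarith [mul_nonneg hC0 hn2, mul_nonneg hC0 hn1]

/-- **Two-point estimate**: the displacement of a holomorphic self-map of the disc on a smaller
disc is controlled, uniformly in the map, by its displacement at two distinct points. -/
lemma exists_norm_map_sub_self_le {ζ₁ ζ₂ : ℂ} (h₁ : ζ₁ ∈ disc) (h₂ : ζ₂ ∈ disc) (hne : ζ₁ ≠ ζ₂)
    {r : ℝ} (hr : r < 1) :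
    ∃ C : ℝ, 0 ≤ C ∧ ∀ f : ℂ → ℂ, DifferentiableOn ℂ f disc → MapsTo f disc disc →
      ∀ z : ℂ, ‖z‖ ≤ r → ‖f z - z‖ ≤ C * (‖f ζ₁ - ζ₁‖ + ‖f ζ₂ - ζ₂‖) := by
  have hn := neg_mem_disc h₁
  set ζ := mob ζ₁ ζ₂ with hζdef
  have hζ : ζ ∈ disc := mob_mem_disc h₁ h₂
  have hζ0 : ζ ≠ 0 :=
    div_ne_zero (sub_ne_zero.2 hne.symm) (one_sub_conj_mul_ne_zero h₁ (norm_lt_one h₂).le)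
  have p0 : 0 < ‖ζ‖ := norm_pos_iff.2 hζ0
  have p1 : 0 < 1 - ‖ζ₁‖ := sub_pos.2 (norm_lt_one h₁)
  have p2 : 0 < 1 - ‖ζ₂‖ := sub_pos.2 (norm_lt_one h₂)
  have p3 : 0 < 1 - ‖ζ‖ := sub_pos.2 (norm_lt_one hζ)
  have p4 : 0 < 1 - r := sub_pos.2 hr
  -- `mob ζ₁` maps the disc of radius `r` to points at distance at least `m` from the circle
  set m := (1 - ‖ζ₁‖) * (1 - r) / 8 with hm_def
  have pm : 0 < m := by positivity
  refine ⟨2 / m * ((16 / ((1 - ‖ζ‖) * m) / ‖ζ‖ + 1) * 4 *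
    (2 / (1 - ‖ζ₁‖) + 2 / (1 - ‖ζ₂‖))), by positivity, fun f hf hm z hzr => ?_⟩
  have hz : z ∈ disc := mem_ball_zero_iff.2 (hzr.trans_lt hr)
  set w := mob ζ₁ z with hw_def
  have hw : w ∈ disc := mob_mem_disc h₁ hz
  have hwm : m ≤ 1 - ‖w‖ := by
    have := norm_mob_le h₁ hz
    have : m ≤ (1 - ‖ζ₁‖) * (1 - ‖z‖) / 8 := by rw [hm_def]; gcongr
    linarith
  set G : ℂ → ℂ := fun x => mob ζ₁ (f (mob (-ζ₁) x)) with hG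
  have hGmob : ∀ x ∈ disc, G (mob ζ₁ x) = mob ζ₁ (f x) := fun x hx => by
    simp only [hG, mob_neg_mob h₁ hx]
  have hGd : DifferentiableOn ℂ G disc :=
    (differentiableOn_mob h₁).comp (hf.comp (differentiableOn_mob hn) (mapsTo_mob hn))
      (hm.comp (mapsTo_mob hn))
  have hGm : MapsTo G disc disc := (mapsTo_mob h₁).comp (hm.comp (mapsTo_mob hn))
  have hG0 : ‖G 0‖ ≤ 2 / (1 - ‖ζ₁‖) * ‖f ζ₁ - ζ₁‖ := by
    have h := norm_map_sub_le (differentiableOn_mob h₁) (mapsTo_mob h₁) h₁ (hm h₁)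
    rw [← hGmob _ h₁] at h
    simpa using h
  have hGζ : ‖G ζ - ζ‖ ≤ 2 / (1 - ‖ζ₂‖) * ‖f ζ₂ - ζ₂‖ := by
    have h := norm_map_sub_le (differentiableOn_mob h₁) (mapsTo_mob h₁) h₂ (hm h₂)
    rwa [← hGmob _ h₂] at h
  have hGw := norm_map_sub_self_le_of_zero hGd hGm hζ hζ0 hw
  have hfz : ‖f z - z‖ ≤ 2 / (1 - ‖w‖) * ‖G w - w‖ := by
    have h := norm_map_sub_le (differentiableOn_mob hn) (mapsTo_mob hn) hw (hGm hw)
    rwa [hGmob z hz, mob_neg_mob h₁ (hm hz), mob_neg_mob h₁ hz, ← hGmob z hz] at h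
  have n1 := norm_nonneg (f ζ₁ - ζ₁)
  have n2 := norm_nonneg (f ζ₂ - ζ₂)
  have hsum : ‖G 0‖ + ‖G ζ - ζ‖ ≤
      (2 / (1 - ‖ζ₁‖) + 2 / (1 - ‖ζ₂‖)) * (‖f ζ₁ - ζ₁‖ + ‖f ζ₂ - ζ₂‖) := by
    have q1 : 0 ≤ 2 / (1 - ‖ζ₁‖) := by positivity
    have q2 : 0 ≤ 2 / (1 - ‖ζ₂‖) := by positivity
    nlinarith [mul_nonneg q1 n2, mul_nonneg q2 n1]
  have hCle : 16 / ((1 - ‖ζ‖) * (1 - ‖w‖)) / ‖ζ‖ ≤ 16 / ((1 - ‖ζ‖) * m) / ‖ζ‖ := by gcongr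
  calc ‖f z - z‖ ≤ 2 / (1 - ‖w‖) * ‖G w - w‖ := hfz
    _ ≤ 2 / m * ((16 / ((1 - ‖ζ‖) * m) / ‖ζ‖ + 1) * 4 *
        ((2 / (1 - ‖ζ₁‖) + 2 / (1 - ‖ζ₂‖)) * (‖f ζ₁ - ζ₁‖ + ‖f ζ₂ - ζ₂‖))) := by
      refine mul_le_mul (by gcongr) (hGw.trans ?_) (norm_nonneg _) (by positivity)
      refine mul_le_mul ?_ hsum (by positivity) (by positivity)
      gcongr
    _ = _ := by ring

/-- A holomorphic map that is close to the identity on a disc is injective on any smaller disc: its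
difference with the identity is a strict contraction there. -/
lemma injOn_of_norm_map_sub_self_le {f : ℂ → ℂ} (hf : DifferentiableOn ℂ f disc) {r R ε : ℝ}
    (hrR : r < R) (hR : R < 1) (hε : ε < R - r)
    (h : ∀ z : ℂ, ‖z‖ ≤ R → ‖f z - z‖ ≤ ε) : InjOn f (Metric.closedBall 0 r) := by
  have hsub : ∀ x ∈ Metric.closedBall (0 : ℂ) r, Metric.closedBall x (R - r) ⊆
      Metric.closedBall 0 R := fun x hx y hy => by
    rw [mem_closedBall_zero_iff] at hx ⊢
    rw [mem_closedBall_iff_norm] at hy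
    have := norm_add_le (y - x) x
    rw [sub_add_cancel] at this
    linarith
  have hd : ∀ x ∈ Metric.closedBall (0 : ℂ) R, DifferentiableAt ℂ (fun z => f z - z) x :=
    fun x hx => (hf.differentiableAt (Metric.isOpen_ball.mem_nhds
      (Metric.closedBall_subset_ball hR hx))).sub differentiableAt_id
  have hRr : 0 < R - r := sub_pos.2 hrR
  have hderiv : ∀ x ∈ Metric.closedBall (0 : ℂ) r,
      ‖deriv (fun z => f z - z) x‖ ≤ ε / (R - r) := fun x hx => by
    refine Complex.norm_deriv_le_of_forall_mem_sphere_norm_le hRr ?_ fun z hz =>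
      h z (mem_closedBall_zero_iff.1 (hsub x hx (Metric.sphere_subset_closedBall hz)))
    refine DifferentiableOn.diffContOnCl_ball (U := Metric.closedBall 0 R) ?_ (hsub x hx)
    exact fun y hy => (hd y hy).differentiableWithinAt
  intro x hx y hy hxy
  have hlip := Convex.norm_image_sub_le_of_norm_deriv_le
    (fun z hz => hd z (Metric.closedBall_subset_closedBall hrR.le hz)) hderiv
    (convex_closedBall 0 r) hx hy
  rw [hxy, sub_sub_sub_cancel_left, norm_sub_rev] at hlip
  by_contra hne
  have hpos : 0 < ‖y - x‖ := norm_pos_iff.2 (sub_ne_zero.2 (Ne.symm hne))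
  have : ε / (R - r) < 1 := (div_lt_one hRr).2 hε
  nlinarith

/-! ### Non-negative `L^d` bounds -/

namespace IsNonnegLp

variable {d : ℝ≥0∞} {T : ℝ} {k l : ℝ → ℝ}

lemma integrableOn (hd : 1 ≤ d) (hk : IsNonnegLp d T k) : IntegrableOn k (Icc 0 T) :=
  hk.2.integrable hd

lemma intervalIntegrable (hd : 1 ≤ d) (hk : IsNonnegLp d T k) {a b : ℝ} (ha : 0 ≤ a)
    (hab : a ≤ b) (hb : b ≤ T) : IntervalIntegrable k volume a b := by
  refine ((hk.integrableOn hd).mono_set ?_).intervalIntegrable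
  rw [uIcc_of_le hab]
  exact Icc_subset_Icc ha hb

lemma integral_nonneg (hk : IsNonnegLp d T k) {a b : ℝ} (ha : 0 ≤ a) (hab : a ≤ b)
    (hb : b ≤ T) : 0 ≤ ∫ ξ in a..b, k ξ :=
  intervalIntegral.integral_nonneg hab fun x hx => hk.1 x ⟨ha.trans hx.1, hx.2.trans hb⟩

lemma add (hk : IsNonnegLp d T k) (hl : IsNonnegLp d T l) :
    IsNonnegLp d T (fun ξ => k ξ + l ξ) :=
  ⟨fun ξ hξ => add_nonneg (hk.1 ξ hξ) (hl.1 ξ hξ), MemLp.add hk.2 hl.2⟩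

lemma const_mul (hk : IsNonnegLp d T k) {c : ℝ} (hc : 0 ≤ c) :
    IsNonnegLp d T (fun ξ => c * k ξ) :=
  ⟨fun ξ hξ => mul_nonneg hc (hk.1 ξ hξ), hk.2.const_mul c⟩

lemma integral_le_integral_add_left (hd : 1 ≤ d) (hk : IsNonnegLp d T k) (hl : IsNonnegLp d T l)
    {a b : ℝ} (ha : 0 ≤ a) (hab : a ≤ b) (hb : b ≤ T) :
    ∫ ξ in a..b, k ξ ≤ ∫ ξ in a..b, (k ξ + l ξ) := by
  rw [intervalIntegral.integral_add (hk.intervalIntegrable hd ha hab hb)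
    (hl.intervalIntegrable hd ha hab hb)]
  linarith [hl.integral_nonneg ha hab hb]

lemma integral_le_integral_add_right (hd : 1 ≤ d) (hk : IsNonnegLp d T k)
    (hl : IsNonnegLp d T l) {a b : ℝ} (ha : 0 ≤ a) (hab : a ≤ b) (hb : b ≤ T) :
    ∫ ξ in a..b, l ξ ≤ ∫ ξ in a..b, (k ξ + l ξ) := by
  rw [intervalIntegral.integral_add (hk.intervalIntegrable hd ha hab hb)
    (hl.intervalIntegrable hd ha hab hb)]
  linarith [hk.integral_nonneg ha hab hb]

lemma comp_sub_left (hk : IsNonnegLp d T k) : IsNonnegLp d T (fun ξ => k (T - ξ)) := by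
  refine ⟨fun ξ hξ => hk.1 _ ⟨sub_nonneg.2 hξ.2, by linarith [hξ.1]⟩, ?_⟩
  have hmp := (Measure.measurePreserving_sub_left (volume : Measure ℝ) T).restrict_preimage
    (measurableSet_Icc (a := (0 : ℝ)) (b := T))
  have hpre : (fun t => T - t) ⁻¹' Icc 0 T = Icc 0 T := by simp
  rw [hpre] at hmp
  exact hk.2.comp_measurePreserving hmp

/-- Extension by zero turns a bound on `[0, T]` into a bound on any `[0, T']`. -/
lemma indicator (hk : IsNonnegLp d T k) (T' : ℝ) : IsNonnegLp d T' ((Icc 0 T).indicator k) :=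
  ⟨fun ξ _ => indicator_nonneg hk.1 ξ,
    ((memLp_indicator_iff_restrict measurableSet_Icc).2 hk.2).restrict _⟩

lemma integral_min_le_integral_indicator (hd : 1 ≤ d) (hk : IsNonnegLp d T k) {a b : ℝ}
    (ha : 0 ≤ a) (hab : a ≤ b) :
    ∫ ξ in min a T..min b T, k ξ ≤ ∫ ξ in a..b, (Icc 0 T).indicator k ξ := by
  have hi := hk.indicator b
  rcases le_total a T with haT | haT
  · have hm : a ≤ min b T := le_min hab haT
    have e : ∫ ξ in a..min b T, k ξ = ∫ ξ in a..min b T, (Icc 0 T).indicator k ξ := by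
      refine intervalIntegral.integral_congr fun ξ hξ => ?_
      rw [uIcc_of_le hm] at hξ
      have hmem : ξ ∈ Icc 0 T := ⟨ha.trans hξ.1, hξ.2.trans (min_le_right _ _)⟩
      exact (indicator_of_mem hmem k).symm
    rw [min_eq_left haT, e]
    exact intervalIntegral.integral_mono_interval le_rfl hm (min_le_left _ _)
      (ae_of_all _ (indicator_nonneg hk.1)) (hi.intervalIntegrable hd ha hab le_rfl)
  · rw [min_eq_right haT, min_eq_right (haT.trans hab), intervalIntegral.integral_same]
    exact hi.integral_nonneg ha hab le_rfl

/-- Absolute continuity of the integral: it is small over short intervals. -/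
lemma exists_integral_lt (hd : 1 ≤ d) (hk : IsNonnegLp d T k) {ε : ℝ} (hε : 0 < ε) :
    ∃ δ : ℝ, 0 < δ ∧ ∀ s t : ℝ, 0 ≤ s → s ≤ t → t ≤ T → t - s < δ → ∫ ξ in s..t, k ξ < ε := by
  rcases lt_or_ge T 0 with hT | hT
  · exact ⟨1, one_pos, fun s t hs hst ht _ => absurd (hs.trans (hst.trans ht)) (not_le.2 hT)⟩
  have hc : ContinuousOn (fun x => ∫ ξ in (0 : ℝ)..x, k ξ) (Icc 0 T) := by
    have h := intervalIntegral.continuousOn_primitive_interval (μ := volume) (a := 0) (b := T)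
      (f := k)
    rw [uIcc_of_le hT] at h
    exact h (hk.integrableOn hd)
  obtain ⟨δ, hδ, h⟩ := Metric.uniformContinuousOn_iff.1
    (isCompact_Icc.uniformContinuousOn_of_continuous hc) ε hε
  refine ⟨δ, hδ, fun s t hs hst ht hlt => ?_⟩
  have h' := h t ⟨hs.trans hst, ht⟩ s ⟨hs, hst.trans ht⟩
    (by rwa [Real.dist_eq, abs_of_nonneg (sub_nonneg.2 hst)])
  rw [Real.dist_eq, ← intervalIntegral.integral_add_adjacent_intervals
    (hk.intervalIntegrable hd le_rfl hs (hst.trans ht)) (hk.intervalIntegrable hd hs hst ht),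
    add_sub_cancel_left] at h'
  exact (le_abs_self _).trans_lt h'

end IsNonnegLp

/-! ### Displacement bounds -/

variable {d : ℝ≥0∞} {φ : ℝ → ℝ → ℂ → ℂ}

/-- The displacement `‖φ s t z - z‖` is bounded by the integral over `[s, t]` of one `L^d` function,
uniformly on each smaller disc and on each time interval `[0, T]`. -/
def LocUnifDisplacement (d : ℝ≥0∞) (φ : ℝ → ℝ → ℂ → ℂ) : Prop :=
  ∀ T : ℝ, 0 < T → ∀ r : ℝ, r < 1 → ∃ k : ℝ → ℝ, IsNonnegLp d T k ∧
    ∀ z : ℂ, ‖z‖ ≤ r → ∀ s t : ℝ, 0 ≤ s → s ≤ t → t ≤ T → ‖φ s t z - z‖ ≤ ∫ ξ in s..t, k ξ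

lemma exists_norm_le_of_isCompact {K : Set ℂ} (hK : IsCompact K) (hKd : K ⊆ disc) :
    ∃ r < 1, ∀ z ∈ K, ‖z‖ ≤ r := by
  rcases K.eq_empty_or_nonempty with rfl | hne
  · exact ⟨0, one_pos, by simp⟩
  · obtain ⟨x, hx, hmax⟩ := hK.exists_isMaxOn hne continuous_norm.continuousOn
    exact ⟨‖x‖, norm_lt_one (hKd hx), fun z hz => hmax hz⟩

/-- By the two-point estimate, it is enough to bound the displacement at two points, which may
depend on `T`. -/
lemma locUnifDisplacement_of_two_points (hφ : IsSelfMapFamily φ)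
    (h : ∀ T : ℝ, 0 < T → ∃ ζ₁ ∈ disc, ∃ ζ₂ ∈ disc, ζ₁ ≠ ζ₂ ∧ ∃ k : ℝ → ℝ, IsNonnegLp d T k ∧
      ∀ s t : ℝ, 0 ≤ s → s ≤ t → t ≤ T →
        ‖φ s t ζ₁ - ζ₁‖ ≤ ∫ ξ in s..t, k ξ ∧ ‖φ s t ζ₂ - ζ₂‖ ≤ ∫ ξ in s..t, k ξ) :
    LocUnifDisplacement d φ := by
  intro T hT r hr
  obtain ⟨ζ₁, h₁, ζ₂, h₂, hne, k, hk, hb⟩ := h T hT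
  obtain ⟨C, hC, hest⟩ := exists_norm_map_sub_self_le h₁ h₂ hne hr
  refine ⟨fun ξ => C * 2 * k ξ, hk.const_mul (by positivity), fun z hz s t hs hst ht => ?_⟩
  obtain ⟨hf, hm⟩ := hφ s t hs hst
  obtain ⟨hb₁, hb₂⟩ := hb s t hs hst ht
  refine (hest _ hf hm z hz).trans ?_
  rw [intervalIntegral.integral_const_mul, mul_assoc]
  exact mul_le_mul_of_nonneg_left (by linarith) hC

lemma TwoPointACd.locUnifDisplacement (hφ : IsSelfMapFamily φ) (hid : DiagId φ)
    (h : TwoPointACd d φ) : LocUnifDisplacement d φ := by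
  refine locUnifDisplacement_of_two_points hφ fun T hT => ?_
  obtain ⟨ζ₁, h₁, ζ₂, h₂, hne, k, hk, hb⟩ := h T hT
  refine ⟨ζ₁, h₁, ζ₂, h₂, hne, k, hk, fun s t hs hst ht => ?_⟩
  have := hb s s t hs le_rfl hst ht
  rwa [hid s hs _ h₁, hid s hs _ h₂] at this

lemma IsReverseEvolutionFamily.twoPointACd (hd : 1 ≤ d) (h : IsReverseEvolutionFamily d φ) :
    TwoPointACd d φ := by
  intro T hT
  have h₁ : (0 : ℂ) ∈ disc := by simp
  have h₂ : (1 / 2 : ℂ) ∈ disc := by rw [mem_ball_zero_iff]; norm_num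
  obtain ⟨k, hk, hkb⟩ := h.ac _ h₁ T hT
  obtain ⟨l, hl, hlb⟩ := h.ac _ h₂ T hT
  refine ⟨0, h₁, 1 / 2, h₂, by norm_num, _, hk.add hl, fun s u t hs hsu hut ht => ⟨?_, ?_⟩⟩
  · rw [norm_sub_rev]
    exact (hkb s u t hs hsu hut ht).trans
      (hk.integral_le_integral_add_left hd hl (hs.trans hsu) hut ht)
  · rw [norm_sub_rev]
    exact (hlb s u t hs hsu hut ht).trans
      (hk.integral_le_integral_add_right hd hl (hs.trans hsu) hut ht)

/-- Since `φ s t z - φ s u z = φ s u (φ u t z) - φ s u z`, the Schwarz–Pick lemma for `φ s u` reduces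
increments in the second parameter to displacements. -/
lemma LocUnifDisplacement.locUnifACdSnd (hφ : IsSelfMapFamily φ) (hc : ReverseComp φ)
    (h : LocUnifDisplacement d φ) : LocUnifACdSnd d φ := by
  intro T hT K hK hKd
  obtain ⟨r, hr, hKr⟩ := exists_norm_le_of_isCompact hK hKd
  obtain ⟨k, hk, hb⟩ := h T hT r hr
  have hr' : 0 < 1 - r := sub_pos.2 hr
  refine ⟨fun ξ => 2 / (1 - r) * k ξ, hk.const_mul (by positivity),
    fun z hz s u t hs hsu hut ht => ?_⟩
  have hu := hs.trans hsu
  obtain ⟨hf, hm⟩ := hφ s u hs hsu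
  rw [hc s u t hs hsu hut z (hKd hz), intervalIntegral.integral_const_mul]
  refine (norm_map_sub_le hf hm (hKd hz) ((hφ u t hu hut).2 (hKd hz))).trans ?_
  have := hKr z hz
  exact mul_le_mul (by gcongr) (hb z this u t hu hut ht) (norm_nonneg _) (by positivity)

lemma LocUnifACdSnd.pointwiseACd (h : LocUnifACdSnd d φ) : PointwiseACd d φ := by
  intro z hz T hT
  obtain ⟨k, hk, hb⟩ := h T hT {z} isCompact_singleton (singleton_subset_iff.2 hz)
  refine ⟨k, hk, fun s u t hs hsu hut ht => ?_⟩
  rw [norm_sub_rev]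
  exact hb z rfl s u t hs hsu hut ht

/-- On `[0, T]`, the maps of the family send a smaller disc into a common smaller disc: this is clear
for short time intervals, on which `0` moves by at most `1 / 2`, and `[0, T]` is cut into finitely
many of these. -/
lemma LocUnifDisplacement.exists_norm_le (hd : 1 ≤ d) (hφ : IsSelfMapFamily φ) (hid : DiagId φ)
    (hc : ReverseComp φ) (h : LocUnifDisplacement d φ) {T : ℝ} (hT : 0 < T) {r : ℝ}
    (hr : r < 1) :
    ∃ R < 1, ∀ z : ℂ, ‖z‖ ≤ r → ∀ s t : ℝ, 0 ≤ s → s ≤ t → t ≤ T → ‖φ s t z‖ ≤ R := by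
  obtain ⟨k, hk, hb⟩ := h T hT 0 one_pos
  obtain ⟨δ, hδ, hsmall⟩ := hk.exists_integral_lt hd (ε := 1 / 2) (by norm_num)
  have hstep : ∀ z ∈ disc, ∀ s t : ℝ, 0 ≤ s → s ≤ t → t ≤ T → t - s < δ →
      (1 - ‖z‖) / 16 ≤ 1 - ‖φ s t z‖ := fun z hz s t hs hst ht hlt => by
    obtain ⟨hf, hm⟩ := hφ s t hs hst
    have h0 : ‖φ s t 0‖ ≤ 1 / 2 := by
      have := hb 0 (by simp) s t hs hst ht
      rw [sub_zero] at this
      exact this.trans (hsmall s t hs hst ht hlt).le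
    have := one_sub_norm_map_ge hf hm hz
    have := norm_lt_one hz
    nlinarith
  have hiter : ∀ n : ℕ, ∀ z ∈ disc, ∀ s t : ℝ, 0 ≤ s → s ≤ t → t ≤ T → t - s ≤ n * (δ / 2) →
      (1 - ‖z‖) / 16 ^ n ≤ 1 - ‖φ s t z‖ := by
    intro n
    induction n with
    | zero =>
      intro z hz s t hs hst ht hle
      obtain rfl : s = t := le_antisymm hst (by simpa using hle)
      simp [hid s hs z hz]
    | succ n ih =>
      intro z hz s t hs hst ht hle
      push_cast at hle
      set u := max s (t - δ / 2) with hu_def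
      have hsu : s ≤ u := le_max_left _ _
      have hut : u ≤ t := max_le hst (by linarith)
      have hu := hs.trans hsu
      have hw := (hφ u t hu hut).2 hz
      have h1 := hstep z hz u t hu hut ht (by linarith [le_max_right s (t - δ / 2)])
      have hus : u - s ≤ n * (δ / 2) := by
        rw [sub_le_iff_le_add]
        exact max_le (by nlinarith [n.cast_nonneg (α := ℝ)]) (by linarith)
      have h2 := ih _ hw s u hs hsu (hut.trans ht) hus
      rw [hc s u t hs hsu hut z hz]
      refine le_trans ?_ h2
      rw [pow_succ', ← div_div]
      gcongr
  obtain ⟨N, hN⟩ := exists_nat_ge (T / (δ / 2))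
  rw [div_le_iff₀ (by positivity)] at hN
  have hr' : 0 < 1 - r := sub_pos.2 hr
  refine ⟨1 - (1 - r) / 16 ^ N, by linarith [show 0 < (1 - r) / 16 ^ N by positivity],
    fun z hz s t hs hst ht => ?_⟩
  have h1 := hiter N z (mem_ball_zero_iff.2 (hz.trans_lt hr)) s t hs hst ht (by linarith)
  have h2 : (1 - r) / 16 ^ N ≤ (1 - ‖z‖) / 16 ^ N := by gcongr
  linarith

/-- Since `φ s t z - φ u t z = φ s u w - w` with `w = φ u t z`, increments in the first parameter are
displacements of points in a common smaller disc. -/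
lemma LocUnifDisplacement.locUnifACdFst (hd : 1 ≤ d) (hφ : IsSelfMapFamily φ) (hid : DiagId φ)
    (hc : ReverseComp φ) (h : LocUnifDisplacement d φ) : LocUnifACdFst d φ := by
  intro T hT K hK hKd
  obtain ⟨r, hr, hKr⟩ := exists_norm_le_of_isCompact hK hKd
  obtain ⟨R, hR, hmap⟩ := h.exists_norm_le hd hφ hid hc hT hr
  obtain ⟨k, hk, hb⟩ := h T hT R hR
  refine ⟨k, hk, fun z hz s u t hs hsu hut ht => ?_⟩
  rw [hc s u t hs hsu hut z (hKd hz)]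
  exact hb _ (hmap z (hKr z hz) u t (hs.trans hsu) hut ht) s u hs hsu (hut.trans ht)

/-! ### Time reversal -/

/-- The evolution family is the time reversal of `φ` on `[0, T]`, stopped at time `T`. -/
lemma LocUnifACdFst.timeReversalIsEvolution (hd : 1 ≤ d) (hφ : IsSelfMapFamily φ)
    (hid : DiagId φ) (hc : ReverseComp φ) (h : LocUnifACdFst d φ) :
    TimeReversalIsEvolution d φ := by
  intro T hT
  have hnn : ∀ a : ℝ, 0 ≤ T - min a T := fun a => sub_nonneg.2 (min_le_right _ _)
  have hmono : ∀ a b : ℝ, a ≤ b → T - min b T ≤ T - min a T := fun a b hab =>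
    sub_le_sub_left (min_le_min_right T hab) T
  refine ⟨fun a b => φ (T - min b T) (T - min a T), ⟨?_, ?_, ?_, ?_⟩, ?_⟩
  · exact fun s t _ hst => hφ _ _ (hnn t) (hmono s t hst)
  · exact fun s _ z hz => hid _ (hnn s) z hz
  · exact fun s u t _ hsu hut z hz => hc _ _ _ (hnn t) (hmono u t hut) (hmono s u hsu) z hz
  · intro z hz T' _
    obtain ⟨k, hk, hb⟩ := h T hT {z} isCompact_singleton (singleton_subset_iff.2 hz)
    refine ⟨_, hk.comp_sub_left.indicator T', fun s u t hs hsu hut _ => ?_⟩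
    have hle : T - min s T ≤ T := sub_le_self _ (le_min hs hT.le)
    have h1 := hb z rfl _ _ _ (hnn t) (hmono u t hut) (hmono s u hsu) hle
    rw [norm_sub_rev, ← intervalIntegral.integral_comp_sub_left] at h1
    exact h1.trans (hk.comp_sub_left.integral_min_le_integral_indicator hd (hs.trans hsu) hut)
  · intro s t hs hst _ z _
    simp only [min_eq_left (sub_le_self T hs), min_eq_left (sub_le_self T (hs.trans hst)),
      sub_sub_cancel]

lemma TimeReversalIsEvolution.locUnifDisplacement (hd : 1 ≤ d) (hφ : IsSelfMapFamily φ)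
    (h : TimeReversalIsEvolution d φ) : LocUnifDisplacement d φ := by
  have key : ∀ T : ℝ, 0 < T → ∀ z ∈ disc, ∃ k : ℝ → ℝ, IsNonnegLp d T k ∧
      ∀ s t : ℝ, 0 ≤ s → s ≤ t → t ≤ T → ‖φ s t z - z‖ ≤ ∫ ξ in s..t, k ξ := by
    intro T hT z hz
    obtain ⟨ψ, hψ, heq⟩ := h T hT
    obtain ⟨k, hk, hb⟩ := hψ.ac z hz T hT
    refine ⟨_, hk.comp_sub_left, fun s t hs hst ht => ?_⟩
    have hTt : 0 ≤ T - t := sub_nonneg.2 ht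
    have h1 := hb (T - t) (T - t) (T - s) hTt le_rfl (by linarith) (by linarith)
    rw [hψ.diag _ hTt z hz, ← heq s t hs hst ht z hz, norm_sub_rev] at h1
    rwa [intervalIntegral.integral_comp_sub_left]
  refine locUnifDisplacement_of_two_points hφ fun T hT => ?_
  have h₁ : (0 : ℂ) ∈ disc := by simp
  have h₂ : (1 / 2 : ℂ) ∈ disc := by rw [mem_ball_zero_iff]; norm_num
  obtain ⟨k, hk, hkb⟩ := key T hT _ h₁
  obtain ⟨l, hl, hlb⟩ := key T hT _ h₂
  exact ⟨0, h₁, 1 / 2, h₂, by norm_num, _, hk.add hl, fun s t hs hst ht =>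
    ⟨(hkb s t hs hst ht).trans (hk.integral_le_integral_add_left hd hl hs hst ht),
      (hlb s t hs hst ht).trans (hk.integral_le_integral_add_right hd hl hs hst ht)⟩⟩

/-! ### Univalence -/

lemma LocUnifACdFst.continuousOn (hd : 1 ≤ d) (h : LocUnifACdFst d φ) {t : ℝ} (ht : 0 < t)
    {z : ℂ} (hz : z ∈ disc) : ContinuousOn (fun u => φ u t z) (Icc 0 t) := by
  obtain ⟨k, hk, hb⟩ := h t ht {z} isCompact_singleton (singleton_subset_iff.2 hz)
  rw [Metric.continuousOn_iff]
  intro a ha ε hε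
  obtain ⟨δ, hδ, hsmall⟩ := hk.exists_integral_lt hd hε
  refine ⟨δ, hδ, fun b hb' hab => ?_⟩
  rw [Real.dist_eq, abs_lt] at hab
  rw [dist_eq_norm]
  rcases le_total a b with hle | hle
  · rw [norm_sub_rev]
    exact (hb z rfl a b t ha.1 hle hb'.2 le_rfl).trans_lt
      (hsmall a b ha.1 hle hb'.2 (by linarith [hab.2]))
  · exact (hb z rfl b a t hb'.1 hle ha.2 le_rfl).trans_lt
      (hsmall b a hb'.1 hle ha.2 (by linarith [hab.1]))

/-- If `φ s t` identifies two distinct points, let `u` be the last time at which `φ u t` identifies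
them. Just after `u`, their images lie in a compact set on which `φ u v` is so close to the identity
that it is injective, so that `φ v t` identifies the two points as well. -/
lemma LocUnifDisplacement.injOn (hd : 1 ≤ d) (hφ : IsSelfMapFamily φ) (hid : DiagId φ)
    (hc : ReverseComp φ) (h : LocUnifDisplacement d φ) {s t : ℝ} (hs : 0 ≤ s) (hst : s ≤ t) :
    InjOn (φ s t) disc := by
  intro z₁ h₁ z₂ h₂ heq
  rcases hst.eq_or_lt with rfl | hlt
  · rwa [hid s hs _ h₁, hid s hs _ h₂] at heq
  have ht : 0 < t := hs.trans_lt hlt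
  have hfst := h.locUnifACdFst hd hφ hid hc
  set Z : Set ℝ := {u ∈ Icc 0 t | φ u t z₁ - φ u t z₂ = 0} with hZ
  have hcont := (hfst.continuousOn hd ht h₁).sub (hfst.continuousOn hd ht h₂)
  have hZc : IsCompact Z := isCompact_Icc.of_isClosed_subset
    (hcont.preimage_isClosed_of_isClosed isClosed_Icc isClosed_singleton) fun u hu => hu.1
  obtain ⟨u, ⟨hu, hu0⟩, hmax⟩ := hZc.exists_isGreatest ⟨s, ⟨hs, hst⟩, sub_eq_zero.2 heq⟩
  rcases hu.2.eq_or_lt with rfl | hut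
  · rwa [hid u hu.1 _ h₁, hid u hu.1 _ h₂, sub_eq_zero] at hu0
  exfalso
  obtain ⟨R, hR, hmap⟩ := h.exists_norm_le hd hφ hid hc ht
    (max_lt (norm_lt_one h₁) (norm_lt_one h₂))
  obtain ⟨k, hk, hb⟩ := h t ht ((1 + R) / 2) (by linarith)
  obtain ⟨δ, hδ, hsmall⟩ := hk.exists_integral_lt hd (ε := (1 - R) / 4) (by linarith)
  set v := min t (u + δ / 2) with hv
  have huv : u < v := lt_min hut (by linarith)
  have hvt : v ≤ t := min_le_left _ _
  have hv0 : 0 ≤ v := hu.1.trans huv.le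
  have hvu : v - u < δ := by linarith [min_le_right t (u + δ / 2)]
  have hinj : InjOn (φ u v) (Metric.closedBall 0 R) :=
    injOn_of_norm_map_sub_self_le (hφ u v hu.1 huv.le).1 (R := (1 + R) / 2) (ε := (1 - R) / 4)
      (by linarith) (by linarith) (by linarith) fun z hz =>
        (hb z hz u v hu.1 huv.le hvt).trans (hsmall u v hu.1 huv.le hvt hvu).le
  rw [hc u v t hu.1 huv.le hvt _ h₁, hc u v t hu.1 huv.le hvt _ h₂, sub_eq_zero] at hu0
  have hveq := hinj
    (mem_closedBall_zero_iff.2 (hmap z₁ (le_max_left _ _) v t hv0 hvt le_rfl))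
    (mem_closedBall_zero_iff.2 (hmap z₂ (le_max_right _ _) v t hv0 hvt le_rfl)) hu0
  exact absurd (hmax ⟨⟨hv0, hvt⟩, sub_eq_zero.2 hveq⟩) (not_le.2 huv)

end Loewner

theorem proposition4p3 (d : ℝ≥0∞) (hd : 1 ≤ d) :
    (∀ φ : ℝ → ℝ → ℂ → ℂ,
      Loewner.IsSelfMapFamily φ → Loewner.DiagId φ → Loewner.ReverseComp φ →
        List.TFAE
          [Loewner.TwoPointACd d φ,
            Loewner.IsReverseEvolutionFamily d φ,
            Loewner.LocUnifACdSnd d φ,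
            Loewner.TimeReversalIsEvolution d φ,
            Loewner.LocUnifACdFst d φ]) ∧
      ∀ φ : ℝ → ℝ → ℂ → ℂ, Loewner.IsReverseEvolutionFamily d φ →
        ∀ s t : ℝ, 0 ≤ s → s ≤ t → Loewner.IsUnivalent (φ s t) := by
  refine ⟨fun φ hφ hid hc => ?_, fun φ h s t hs hst => ⟨(h.selfMap s t hs hst).1, ?_⟩⟩
  · tfae_have 1 → 3 := fun h => (h.locUnifDisplacement hφ hid).locUnifACdSnd hφ hc
    tfae_have 3 → 2 := fun h => ⟨hφ, hid, hc, h.pointwiseACd⟩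
    tfae_have 2 → 1 := fun h => h.twoPointACd hd
    tfae_have 1 → 5 := fun h => (h.locUnifDisplacement hφ hid).locUnifACdFst hd hφ hid hc
    tfae_have 5 → 4 := fun h => h.timeReversalIsEvolution hd hφ hid hc
    tfae_have 4 → 3 := fun h => (h.locUnifDisplacement hd hφ).locUnifACdSnd hφ hc
    tfae_finish
  · exact ((h.twoPointACd hd).locUnifDisplacement h.selfMap h.diag).injOn hd h.selfMap h.diag
      h.comp hs hst
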